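/- Burning second-price auction. Let $c\ge 1$ be an integer and $\gamma\in(0,1]$. **Mechanism.** Bids and true values are nonnegative reals. The parameters are integers $k,k'\ge 0$ with block size $B=k+k'$ and $1\le k'\le\lfloor \gamma k/c\rfloor$. The miner includes the $B$ highest bids, $b_1\ge\dots\ge b_B$ (all of them if there are fewer than $B$). The blockchain ranks the bids recorded in the block in descending order; empty slots count as bids $0$; ties are broken arbitrarily both in the inclusion and in the ranking. A uniformly random subset of size exactly $\lfloor\gamma k/c\rfloor$ of the top $k$ slots is confirmed. Each confirmed bid pays $b_{k+1}$, unconfirmed bids pay nothing, the miner receives $\gamma(b_{k+1}+\dots+b_{k+k'})$, and the rest of the payment is burnt. **Utility.** A strategic player is a user, the miner, or the miner together with some users. It knows all other users' bids; its users may bid arbitrarily, it may inject any number of fake transactions (true value $0$) with arbitrary bids, and, if it contains the miner, it may put into the block any at most $B$ of the pending transactions. Its $\gamma$-strict utility is the miner's revenue (if it contains the miner), plus, for each real or fake transaction it submitted, with true value $v$ and bid $b$: $v-p$ if the transaction is confirmed and pays $p$; $-\gamma(b-v)$ if it is unconfirmed and $b>v$; $0$ otherwise. UIC (respectively MIC,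 $c$-SCP) under $\gamma$-strict utility means: for every number of users and every bids of the other users, the expected $\gamma$-strict utility of every single user with an honest miner (respectively of the miner; of every coalition of the miner with at least one and at most $c$ users) is maximized by bidding truthfully, injecting nothing and, if it contains the miner, following the inclusion rule. **Theorem.** (i) For every natural number $B$, admissible parameters $k,k'$ with $k+k'=B$ exist if and only if $B\ge 1+c/\gamma$; in particular the auction can be run with every sufficiently large finite block size. (ii) For all admissible $k,k'$ and all ways of breaking ties, the burning second-price auction has block size $B$ and is a transaction fee mechanism (in every outcome unconfirmed bids pay $0$, no bid pays more than itself, and the miner's revenue is at most the total payment), and it satisfies UIC, MIC and $c$-SCP under $\gamma$-strict utility. (iii) It is deterministic (on every block the set of confirmed bids does not depend on the random coins) if and only if $c=1$ and $\gamma=1$. -/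

import Mathlib

open scoped NNReal

namespace FeeMechanism

/-- The choice of a block from a mempool with `m` pending transactions: a list of at most `B`
distinct transactions. -/
structure Selection (m B : ℕ) where
  len : ℕ
  len_le : len ≤ B
  idx : Fin len ↪ Fin m

/-- The data of a transaction fee mechanism with finite block size. Bids are nonnegative reals.
The inclusion rule is run by the miner on the whole bid vector. The other rules are run by the
blockchain and see only the bids recorded in the block; the (random) confirmation rule
outputs the set of confirmed positions of the block, and the payment and
miner-revenue rules depend on the block and on the confirmed set. -/
structure Mechanism where
  blockSize : ℕ
  inclusion : ∀ {m : ℕ}, (Fin m → ℝ≥0) → Selection m blockSize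
  confirmation : ∀ {l : ℕ}, (Fin l → ℝ≥0) → PMF (Finset (Fin l))
  payment : ∀ {l : ℕ}, (Fin l → ℝ≥0) → Finset (Fin l) → Fin l → ℝ
  revenue : ∀ {l : ℕ}, (Fin l → ℝ≥0) → Finset (Fin l) → ℝ

/-- The requirements on a transaction fee mechanism: in every possible outcome unconfirmed bids pay
nothing, nobody pays more than its bid, and the miner's revenue is at most the total payment. -/
def Mechanism.IsTFM (M : Mechanism) : Prop :=
  ∀ (l : ℕ), l ≤ M.blockSize → ∀ (e : Fin l → ℝ≥0), ∀ S ∈ (M.confirmation e).support,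
    (∀ j, j ∉ S → M.payment e S j = 0) ∧
    (∀ j, M.payment e S j ≤ (e j : ℝ)) ∧
    M.revenue e S ≤ ∑ j ∈ S, M.payment e S j

/-- On every block the set of confirmed bids is determined (no random coins are used). -/
def Mechanism.IsDeterministic (M : Mechanism) : Prop :=
  ∀ (l : ℕ), l ≤ M.blockSize → ∀ (e : Fin l → ℝ≥0), ∃ S, M.confirmation e = PMF.pure S

/-- A mempool arising from `n` users: user `i` submits the transaction at position `pos i`, and
every position outside the range of `pos` is an injected fake transaction. -/
structure Mempool (n : ℕ) where
  size : ℕ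
  bid : Fin size → ℝ≥0
  pos : Fin n ↪ Fin size

/-- The mempool in which the users bid `b` and nobody injects anything. -/
def Mempool.ofBids {n : ℕ} (b : Fin n → ℝ≥0) : Mempool n where
  size := n
  bid := b
  pos := Function.Embedding.refl _

/-- The mempools that a strategic player with users `C` can bring about when the other
users bid according to `b`: the players in `C` bid anything, and any number of fake transactions
with any bids are injected at any positions. -/
def Mempool.Reachable {n : ℕ} (P : Mempool n) (b : Fin n → ℝ≥0) (C : Finset (Fin n)) : Prop :=
  ∀ i, i ∉ C → P.bid (P.pos i) = b i

/-- The transactions of the strategic player with users `C`: those of its users,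
and all fake ones. -/
def Mempool.own {n : ℕ} (P : Mempool n) (C : Finset (Fin n)) : Finset (Fin P.size) :=
  Finset.univ.filter fun t => ∀ i, P.pos i = t → i ∈ C

/-- True values of the transactions: `v i` for that of user `i`, and `0` for a fake one. -/
noncomputable def Mempool.value {n : ℕ} (P : Mempool n) (v : Fin n → ℝ≥0) : Fin P.size → ℝ≥0 :=
  Function.extend P.pos v 0

/-- `γ`-strict utility, in the outcome where the block is `s` and its positions in `S` are
confirmed, of the strategic player consisting of the users in `C`, together with the miner if
`withMiner` is true. -/
noncomputable def Mechanism.strictUtility (M : Mechanism) (γ : ℝ) (withMiner : Bool) {n : ℕ}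
    (v : Fin n → ℝ≥0) (C : Finset (Fin n)) (P : Mempool n) (s : Selection P.size M.blockSize)
    (S : Finset (Fin s.len)) : ℝ :=
  (if withMiner then M.revenue (P.bid ∘ s.idx) S else 0)
  + ∑ j ∈ S with s.idx j ∈ P.own C,
      ((P.value v (s.idx j) : ℝ) - M.payment (P.bid ∘ s.idx) S j)
  - ∑ t ∈ P.own C \ S.map s.idx,
      (if P.value v t < P.bid t then γ * ((P.bid t : ℝ) - (P.value v t : ℝ)) else 0)

/-- Expected `γ`-strict utility over the coins of the confirmation rule. -/
noncomputable def Mechanism.expectedUtility (M : Mechanism) (γ : ℝ) (withMiner : Bool) {n : ℕ}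
    (v : Fin n → ℝ≥0) (C : Finset (Fin n)) (P : Mempool n)
    (s : Selection P.size M.blockSize) : ℝ :=
  ∑ S : Finset (Fin s.len),
    (M.confirmation (P.bid ∘ s.idx) S).toReal * M.strictUtility γ withMiner v C P s S

/-- User incentive compatibility under `γ`-strict utility: when the miner is honest, no user `i`
gains by bidding untruthfully and injecting fake transactions. -/
def Mechanism.UIC (M : Mechanism) (γ : ℝ) : Prop :=
  ∀ (n : ℕ) (v b : Fin n → ℝ≥0) (i : Fin n), b i = v i →
    ∀ P : Mempool n, P.Reachable b {i} →
      M.expectedUtility γ false v {i} P (M.inclusion P.bid) ≤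
        M.expectedUtility γ false v {i} (Mempool.ofBids b) (M.inclusion b)

/-- Miner incentive compatibility under `γ`-strict utility: whatever the users bid, the miner does
not gain by injecting fake transactions and choosing another block. -/
def Mechanism.MIC (M : Mechanism) (γ : ℝ) : Prop :=
  ∀ (n : ℕ) (v b : Fin n → ℝ≥0),
    ∀ P : Mempool n, P.Reachable b ∅ → ∀ s : Selection P.size M.blockSize,
      M.expectedUtility γ true v ∅ P s ≤
        M.expectedUtility γ true v ∅ (Mempool.ofBids b) (M.inclusion b)

/-- `c`-side-contract-proofness under `γ`-strict utility: no coalition of the miner with at least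
one and at most `c` users gains by untruthful bids of its users, fake transactions, and another
choice of the block. -/
def Mechanism.SCP (M : Mechanism) (c : ℕ) (γ : ℝ) : Prop :=
  ∀ (n : ℕ) (v b : Fin n → ℝ≥0) (C : Finset (Fin n)), 1 ≤ C.card → C.card ≤ c →
    (∀ i ∈ C, b i = v i) →
    ∀ P : Mempool n, P.Reachable b C → ∀ s : Selection P.size M.blockSize,
      M.expectedUtility γ true v C P s ≤
        M.expectedUtility γ true v C (Mempool.ofBids b) (M.inclusion b)

/-- A way to rank bid vectors in descending order, with ties broken arbitrarily:
`perm b j` is the position of the bid of rank `j` (ranks start at `0`). -/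
structure Ranking where
  perm : ∀ {m : ℕ}, (Fin m → ℝ≥0) → Equiv.Perm (Fin m)
  antitone : ∀ {m : ℕ} (b : Fin m → ℝ≥0), Antitone (b ∘ perm b)

instance : Nonempty Ranking :=
  ⟨{ perm := fun b => Tuple.sort (OrderDual.toDual ∘ b)
     antitone := fun b i j hij => Tuple.monotone_sort (OrderDual.toDual ∘ b) hij }⟩

/-- The bid of rank `j` (from `0`) of a block, empty slots counting as bids of `0`. -/
def Ranking.bidAt (τ : Ranking) {l : ℕ} (e : Fin l → ℝ≥0) (j : ℕ) : ℝ≥0 :=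
  if h : j < l then e (τ.perm e ⟨j, h⟩) else 0

/-- The number of slots among the top `k` that get confirmed. -/
noncomputable def numConfirmed (c : ℕ) (γ : ℝ) (k : ℕ) : ℕ := ⌊γ * k / c⌋₊

theorem numConfirmed_le {c : ℕ} {γ : ℝ} (hc : 1 ≤ c) (hγ : γ ≤ 1) (k : ℕ) :
    numConfirmed c γ k ≤ k := by
  refine Nat.floor_le_of_le ?_
  have hc' : (1 : ℝ) ≤ c := by exact_mod_cast hc
  have hk : (0 : ℝ) ≤ k := Nat.cast_nonneg k
  rw [div_le_iff₀ (by linarith)]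
  nlinarith

/-- The parameters of the burning second-price auction with block size `B`: `k` eligible
slots and `k'` slots that only set the price and the miner's revenue. -/
def AdmissibleParams (c : ℕ) (γ : ℝ) (B k k' : ℕ) : Prop :=
  k + k' = B ∧ 1 ≤ k' ∧ k' ≤ numConfirmed c γ k

/-- The burning second-price auction. The miner includes the `k + k'` highest bids according to
the ranking `ρ`. The blockchain ranks the included bids by `τ`, and a uniformly random set of
`⌊γ k / c⌋` of the first `k` slots is confirmed. Confirmed bids pay the bid of rank `k + 1`,
and the miner gets `γ` times the sum of the bids of ranks `k + 1, …, k + k'`. -/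
noncomputable def burningSecondPrice (c : ℕ) (γ : ℝ) (hc : 1 ≤ c) (hγ : γ ≤ 1) (k k' : ℕ)
    (ρ τ : Ranking) : Mechanism where
  blockSize := k + k'
  inclusion {m} b :=
    { len := min (k + k') m
      len_le := min_le_left _ _
      idx := (Fin.castLEEmb (min_le_right _ _)).trans (ρ.perm b).toEmbedding }
  confirmation {_} e :=
    (PMF.uniformOfFinset (Finset.powersetCard (numConfirmed c γ k) (Finset.range k))
      (Finset.powersetCard_nonempty.2 (by simpa using numConfirmed_le hc hγ k))).map
      fun T => Finset.univ.filter fun i => (((τ.perm e).symm i : Fin _) : ℕ) ∈ T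
  payment e S j := if j ∈ S then (τ.bidAt e k : ℝ) else 0
  revenue e _ := γ * ∑ j ∈ Finset.range k', (τ.bidAt e (k + j) : ℝ)

end FeeMechanism

/-! ### Admissible parameters -/

namespace FeeMechanism

/-! Utility is affine in the indicators of confirmation, so in expectation the coins matter only
through the probability q = ⌊γk/c⌋/k that an eligible slot is confirmed (`expectedUtility_eq`). The
floor gives q ≤ 1 and cq ≤ γ.

Let a coalition C with the miner make a block with price p. An overbid costs γ per unit, the rate at
which the miner earns on recorded bids. Hence, slot by slot, the utility is bounded by an expression
in p and true values alone (`expectedUtility_le`). Including the highest bids maximizes its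
truncated sum (`sum_min_le_inclusion`), which leaves the bound γ ∑_{j<k'} min(p, H_{k+j}) + q
∑_{i∈C} (b_i - p)⁺, with H the ranked bids of the honest block. At p = H_k this is the honest
utility. A higher p does not increase it. A lower p loses at least γ(H_k - p) of revenue and gains
at most cq(H_k - p), which is no more.

A single user facing an honest miner cannot be eligible at a price below the truthful one
(`bidAt_inclusion_le_of_eligible`), and its overbids and fakes bring no gain.

The outcome is free of coins exactly when all k eligible slots are confirmed, which forces c ≤ γ. -/

theorem numConfirmed_mul_le {c : ℕ} {γ : ℝ} (hc : 1 ≤ c) (hγ : 0 ≤ γ) (k : ℕ) :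
    (numConfirmed c γ k : ℝ) * c ≤ γ * k := by
  have hc' : (0 : ℝ) < c := by exact_mod_cast hc
  have := Nat.floor_le (show 0 ≤ γ * k / c by positivity)
  rwa [le_div_iff₀ hc'] at this

theorem exists_admissibleParams_iff {c : ℕ} {γ : ℝ} (hc : 1 ≤ c) (hγ : 0 < γ) (B : ℕ) :
    (∃ k k' : ℕ, AdmissibleParams c γ B k k') ↔ 1 + (c : ℝ) / γ ≤ (B : ℝ) := by
  have hc' : (0 : ℝ) < c := by exact_mod_cast hc
  constructor
  · rintro ⟨k, k', hB, h1, hk⟩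
    have hm : (1 : ℝ) ≤ numConfirmed c γ k := by exact_mod_cast h1.trans hk
    have h2 := numConfirmed_mul_le hc hγ.le k
    have h3 : (c : ℝ) / γ ≤ k := by
      rw [div_le_iff₀ hγ]
      nlinarith
    have h4 : (1 : ℝ) ≤ k' := by exact_mod_cast h1
    rw [← hB]
    push_cast
    linarith
  · intro h
    have h0 : 0 < (c : ℝ) / γ := by positivity
    have hB : 1 ≤ B := by
      have : (1 : ℝ) ≤ B := by linarith
      exact_mod_cast this
    -- One price slot is the cheapest choice: it leaves the most eligible slots and needs only γk/c
    -- ≥ 1.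
    refine ⟨B - 1, 1, by omega, le_rfl, Nat.le_floor ?_⟩
    rw [le_div_iff₀ hc']
    push_cast [hB]
    have : (c : ℝ) / γ ≤ B - 1 := by linarith
    rw [div_le_iff₀ hγ] at this
    linarith

/-! ### Ranks and positions in a block -/

namespace Ranking

variable (τ : Ranking) {l : ℕ} (e : Fin l → ℝ≥0)

/-- The rank (from `0`) of a position. -/
def rank (j : Fin l) : ℕ := (τ.perm e).symm j

theorem rank_lt (j : Fin l) : τ.rank e j < l := ((τ.perm e).symm j).isLt

theorem rank_injective : Function.Injective (τ.rank e) := fun i j h =>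
  (τ.perm e).symm.injective (Fin.ext h)

theorem bidAt_of_le {k : ℕ} (h : l ≤ k) : τ.bidAt e k = 0 := dif_neg (by omega)

theorem bidAt_rank (j : Fin l) : τ.bidAt e (τ.rank e j) = e j := by
  simp [bidAt, rank]

theorem bidAt_antitone : Antitone (τ.bidAt e) := by
  intro i j hij
  by_cases hj : j < l
  · rw [bidAt, bidAt, dif_pos hj, dif_pos (by omega)]
    exact τ.antitone e (by simpa using hij)
  · rw [τ.bidAt_of_le e (by omega)]
    exact zero_le

theorem bidAt_le {k : ℕ} {j : Fin l} (h : τ.rank e j ≤ k) : τ.bidAt e k ≤ e j := by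
  rw [← τ.bidAt_rank e j]
  exact τ.bidAt_antitone e h

theorem le_bidAt {k : ℕ} {j : Fin l} (h : k ≤ τ.rank e j) : e j ≤ τ.bidAt e k := by
  rw [← τ.bidAt_rank e j]
  exact τ.bidAt_antitone e h

theorem sum_fin_rank (G : ℕ → ℝ) : ∑ j, G (τ.rank e j) = ∑ r ∈ Finset.range l, G r := by
  rw [Finset.sum_range]
  exact Equiv.sum_comp (τ.perm e).symm fun r => G r

/-- Passes from ranks to positions; the empty slots beyond `l` drop out because `F` vanishes at the
bid 0. -/
theorem sum_range_bidAt {N : ℕ} (hN : l ≤ N) (F : ℕ → ℝ≥0 → ℝ) (hF : ∀ r, F r 0 = 0) :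
    ∑ r ∈ Finset.range N, F r (τ.bidAt e r) = ∑ j, F (τ.rank e j) (e j) := by
  have h := τ.sum_fin_rank e fun r => F r (τ.bidAt e r)
  simp only [bidAt_rank] at h
  rw [h]
  refine (Finset.sum_subset (Finset.range_subset_range.2 hN) fun r _ hr => ?_).symm
  rw [τ.bidAt_of_le e (by simpa using hr), hF]

theorem sum_bidAt_add {k k' : ℕ} (hl : l ≤ k + k') :
    ∑ j ∈ Finset.range k', (τ.bidAt e (k + j) : ℝ) =
      ∑ j, if k ≤ τ.rank e j then (e j : ℝ) else 0 := by
  rw [← τ.sum_range_bidAt e hl (fun r x => if k ≤ r then (x : ℝ) else 0) (by simp),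
    Finset.sum_range_add]
  have h : ∑ r ∈ Finset.range k, (if k ≤ r then (τ.bidAt e r : ℝ) else 0) = 0 :=
    Finset.sum_eq_zero fun r hr => if_neg (by simpa using hr)
  simp [h]

/-- As many bids as there are eligible slots count as `bidAt e k`, unless that is zero. -/
theorem sum_rank_lt_bidAt (k : ℕ) :
    ∑ j, (if τ.rank e j < k then (τ.bidAt e k : ℝ) else 0) = k * τ.bidAt e k := by
  rw [τ.sum_fin_rank e fun r => if r < k then (τ.bidAt e k : ℝ) else 0]
  rcases le_or_gt l k with h | h
  · simp [τ.bidAt_of_le e h]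
  · rw [← Finset.sum_filter, Finset.sum_const, nsmul_eq_mul]
    congr 2
    rw [show (Finset.range l).filter (· < k) = Finset.range k by ext; simp; omega,
      Finset.card_range]

theorem card_rank_lt_le (k : ℕ) : (Finset.univ.filter fun j => τ.rank e j < k).card ≤ k := by
  conv_rhs => rw [← Finset.card_range k]
  exact Finset.card_le_card_of_injOn (τ.rank e) (by intro; simp) (τ.rank_injective e).injOn

/-- The positions of the given ranks. -/
def ofRanks (T : Finset ℕ) : Finset (Fin l) := Finset.univ.filter fun j => τ.rank e j ∈ T

theorem mem_ofRanks {T : Finset ℕ} {j : Fin l} : j ∈ τ.ofRanks e T ↔ τ.rank e j ∈ T := by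
  simp [ofRanks]

theorem card_ofRanks {T : Finset ℕ} (hT : T ⊆ Finset.range l) : (τ.ofRanks e T).card = T.card := by
  refine Finset.card_bij (fun j _ => τ.rank e j) (fun j hj => (τ.mem_ofRanks e).1 hj)
    (fun i _ j _ h => τ.rank_injective e h) fun r hr => ?_
  have hl : r < l := by simpa using hT hr
  have : τ.rank e (τ.perm e ⟨r, hl⟩) = r := by simp [rank]
  exact ⟨τ.perm e ⟨r, hl⟩, (τ.mem_ofRanks e).2 (by rwa [this]), this⟩

end Ranking

/-! ### Uniform random subsets and confirmation probabilities -/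

/-- Expectation under the image of a uniform distribution. -/
theorem sum_map_uniformOfFinset {α β : Type*} [Fintype β] (s : Finset α)
    (hs : s.Nonempty) (f : α → β) (F : β → ℝ) :
    ∑ b, ((PMF.uniformOfFinset s hs).map f b).toReal * F b = (s.card : ℝ)⁻¹ * ∑ a ∈ s, F (f a) := by
  classical
  have key : ∀ b, ((PMF.uniformOfFinset s hs).map f b).toReal =
      ∑ a ∈ s, if b = f a then (s.card : ℝ)⁻¹ else 0 := by
    intro b
    rw [PMF.map_apply, tsum_eq_sum (s := s), ENNReal.toReal_sum]
    · refine Finset.sum_congr rfl fun a ha => ?_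
      split_ifs <;> simp [ha]
    · intro a ha
      split_ifs <;> simp [ha, hs.ne_empty]
    · intro a ha
      simp [ha]
  simp only [key, Finset.sum_mul]
  rw [Finset.sum_comm, Finset.mul_sum]
  refine Finset.sum_congr rfl fun a _ => ?_
  simp [ite_mul]

/-- The sets avoiding `r` number C(k-1, m), so those containing it number C(k-1, m-1), and k·C(k-1,
m-1) = m·C(k, m). This makes `confirmProb` the marginal probability of each eligible slot. -/
theorem card_powersetCard_filter_mem {k m r : ℕ} (hm : 1 ≤ m) (hr : r < k) :
    k * ((Finset.powersetCard m (Finset.range k)).filter (r ∈ ·)).card = m * k.choose m := by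
  have h1 : (Finset.powersetCard m (Finset.range k)).filter (r ∉ ·) =
      Finset.powersetCard m ((Finset.range k).erase r) := by
    ext T
    simp only [Finset.mem_filter, Finset.mem_powersetCard, Finset.subset_erase]
    tauto
  have h2 := Finset.card_filter_add_card_filter_not (s := Finset.powersetCard m (Finset.range k))
    (r ∈ ·)
  rw [h1, Finset.card_powersetCard, Finset.card_powersetCard,
    Finset.card_erase_of_mem (by simpa using hr), Finset.card_range] at h2
  obtain ⟨k, rfl⟩ : ∃ a, k = a + 1 := ⟨k - 1, by omega⟩
  obtain ⟨m, rfl⟩ : ∃ a, m = a + 1 := ⟨m - 1, by omega⟩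
  simp only [Nat.add_sub_cancel] at h2
  have h3 := Nat.add_one_mul_choose_eq k m
  have h4 := Nat.choose_succ_succ k m
  have h5 : ((Finset.powersetCard (m + 1) (Finset.range (k + 1))).filter (r ∈ ·)).card =
      k.choose m := by
    simp only [Nat.succ_eq_add_one] at h4
    omega
  rw [h5, h3, mul_comm]

/-- The probability with which an eligible slot is confirmed. -/
noncomputable def confirmProb (c : ℕ) (γ : ℝ) (k : ℕ) : ℝ := (numConfirmed c γ k : ℝ) / k

theorem confirmProb_nonneg {c : ℕ} {γ : ℝ} {k : ℕ} : 0 ≤ confirmProb c γ k := by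
  unfold confirmProb
  positivity

theorem confirmProb_le_one {c : ℕ} {γ : ℝ} (hc : 1 ≤ c) (hγ : γ ≤ 1) {k : ℕ} :
    confirmProb c γ k ≤ 1 :=
  div_le_one_of_le₀ (by exact_mod_cast numConfirmed_le hc hγ k) (by positivity)

theorem mul_confirmProb_le {c : ℕ} {γ : ℝ} (hc : 1 ≤ c) (hγ : 0 ≤ γ) {k : ℕ} :
    c * confirmProb c γ k ≤ γ := by
  rw [confirmProb, ← mul_div_assoc, mul_comm]
  exact div_le_of_le_mul₀ (by positivity) hγ (numConfirmed_mul_le hc hγ k)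

theorem _root_.PMF.support_eq_singleton_iff_eq_pure {α : Type*} {p : PMF α} {a : α} :
    p.support = {a} ↔ p = PMF.pure a := by
  refine ⟨fun h => ?_, fun h => h ▸ PMF.support_pure a⟩
  ext x
  by_cases hx : x = a
  · rw [hx, (p.apply_eq_one_iff a).2 h, PMF.pure_apply_self]
  · rw [(p.apply_eq_zero_iff x).2 (by simpa [h] using hx), PMF.pure_apply_of_ne _ _ hx]

/-! ### Expected utility through marginal probabilities -/

section Auction

variable {c : ℕ} {γ : ℝ} (hc : 1 ≤ c) (hγ : γ ≤ 1) {k k' : ℕ} (ρ τ : Ranking)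

theorem sum_confirmation_mul {l : ℕ} (e : Fin l → ℝ≥0) (F : Finset (Fin l) → ℝ) :
    ∑ S, ((burningSecondPrice c γ hc hγ k k' ρ τ).confirmation e S).toReal * F S =
      (k.choose (numConfirmed c γ k) : ℝ)⁻¹ *
        ∑ T ∈ Finset.powersetCard (numConfirmed c γ k) (Finset.range k), F (τ.ofRanks e T) := by
  have h := sum_map_uniformOfFinset
    (Finset.powersetCard (numConfirmed c γ k) (Finset.range k))
    (Finset.powersetCard_nonempty.2 (by simpa using numConfirmed_le hc hγ k)) (τ.ofRanks e) F
  simp only [Finset.card_powersetCard, Finset.card_range] at h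
  exact h

/-- Expectation of a quantity that is affine in the indicators of confirmation. -/
theorem sum_confirmation_mul_affine (hm : 1 ≤ numConfirmed c γ k) {l : ℕ} (e : Fin l → ℝ≥0)
    (A : ℝ) (D : Fin l → ℝ) :
    ∑ S, ((burningSecondPrice c γ hc hγ k k' ρ τ).confirmation e S).toReal *
        (A + ∑ j ∈ S, D j) =
      A + confirmProb c γ k * ∑ j, if τ.rank e j < k then D j else 0 := by
  have hmk := numConfirmed_le hc hγ k
  rw [sum_confirmation_mul]
  set m := numConfirmed c γ k with hm_def
  have hN : (0 : ℝ) < k.choose m := by exact_mod_cast Nat.choose_pos hmk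
  have hk : (0 : ℝ) < k := by exact_mod_cast (by omega : 0 < k)
  have hcount : ∀ j, (∑ T ∈ Finset.powersetCard m (Finset.range k),
      if τ.rank e j ∈ T then D j else 0) =
      k.choose m * (confirmProb c γ k * if τ.rank e j < k then D j else 0) := by
    intro j
    rw [← Finset.sum_filter, Finset.sum_const, nsmul_eq_mul]
    split_ifs with hj
    · have h := card_powersetCard_filter_mem hm hj
      have h' : (k : ℝ) * ((Finset.powersetCard m (Finset.range k)).filter
          (τ.rank e j ∈ ·)).card = m * k.choose m := by exact_mod_cast h
      rw [confirmProb, ← hm_def]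
      field_simp
      linear_combination D j * h'
    · rw [Finset.filter_false_of_mem]
      · simp
      · intro T hT hjT
        exact hj (Finset.mem_range.1 ((Finset.mem_powersetCard.1 hT).1 hjT))
  have hT : ∀ T, ∑ j ∈ τ.ofRanks e T, D j = ∑ j, if τ.rank e j ∈ T then D j else 0 := by
    intro T
    rw [Ranking.ofRanks, Finset.sum_filter]
  simp only [hT]
  rw [Finset.sum_add_distrib, Finset.sum_comm, Finset.sum_congr rfl fun j _ => hcount j,
    ← Finset.mul_sum, ← Finset.mul_sum, Finset.sum_const, Finset.card_powersetCard,
    Finset.card_range, nsmul_eq_mul]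
  field_simp

/-- The part of a bid that exceeds the true value. -/
noncomputable def Mempool.overbid {n : ℕ} (P : Mempool n) (v : Fin n → ℝ≥0) (t : Fin P.size) : ℝ :=
  max ((P.bid t : ℝ) - P.value v t) 0

theorem Mempool.overbid_nonneg {n : ℕ} (P : Mempool n) (v : Fin n → ℝ≥0) (t : Fin P.size) :
    0 ≤ P.overbid v t := le_max_right _ _

theorem Mempool.ite_overbid {n : ℕ} (P : Mempool n) (v : Fin n → ℝ≥0) (t : Fin P.size) :
    (if P.value v t < P.bid t then γ * ((P.bid t : ℝ) - (P.value v t : ℝ)) else 0) =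
      γ * P.overbid v t := by
  rw [overbid]
  split_ifs with h
  · rw [max_eq_left (sub_nonneg.2 (NNReal.coe_le_coe.2 h.le))]
  · rw [max_eq_right (sub_nonpos.2 (NNReal.coe_le_coe.2 (not_lt.1 h))), mul_zero]

/-- Every own overbid is penalized up front and the penalty is refunded on confirmation. Only the
last sum then depends on `S`, as `sum_confirmation_mul_affine` requires. -/
theorem strictUtility_eq (w : Bool) {n : ℕ} (v : Fin n → ℝ≥0)
    (C : Finset (Fin n)) (P : Mempool n) (s : Selection P.size (k + k')) (S : Finset (Fin s.len)) :
    (burningSecondPrice c γ hc hγ k k' ρ τ).strictUtility γ w v C P s S =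
      ((if w then γ * ∑ j ∈ Finset.range k', (τ.bidAt (P.bid ∘ s.idx) (k + j) : ℝ) else 0)
        - ∑ t ∈ P.own C, γ * P.overbid v t)
      + ∑ j ∈ S, if s.idx j ∈ P.own C then (P.value v (s.idx j) : ℝ)
          - τ.bidAt (P.bid ∘ s.idx) k + γ * P.overbid v (s.idx j) else 0 := by
  have h1 : ∑ t ∈ P.own C \ S.map s.idx, γ * P.overbid v t =
      ∑ t ∈ P.own C, γ * P.overbid v t -
        ∑ j ∈ S, if s.idx j ∈ P.own C then γ * P.overbid v (s.idx j) else 0 := by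
    rw [eq_sub_iff_add_eq, ← Finset.sum_map S s.idx
      (fun t => if t ∈ P.own C then γ * P.overbid v t else 0), ← Finset.sum_filter,
      Finset.filter_mem_eq_inter, Finset.inter_comm, add_comm,
      Finset.sum_inter_add_sum_sdiff]
  have h2 : ∑ j ∈ S with s.idx j ∈ P.own C, ((P.value v (s.idx j) : ℝ) -
      (burningSecondPrice c γ hc hγ k k' ρ τ).payment (P.bid ∘ s.idx) S j) =
      ∑ j ∈ S, if s.idx j ∈ P.own C then (P.value v (s.idx j) : ℝ)
          - τ.bidAt (P.bid ∘ s.idx) k else 0 := by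
    rw [Finset.sum_filter]
    refine Finset.sum_congr rfl fun j hj => ?_
    simp [burningSecondPrice, hj]
  have h3 : ∑ j ∈ S, (if s.idx j ∈ P.own C then (P.value v (s.idx j) : ℝ)
          - τ.bidAt (P.bid ∘ s.idx) k + γ * P.overbid v (s.idx j) else 0) =
      ∑ j ∈ S, (if s.idx j ∈ P.own C then (P.value v (s.idx j) : ℝ)
          - τ.bidAt (P.bid ∘ s.idx) k else 0) +
      ∑ j ∈ S, if s.idx j ∈ P.own C then γ * P.overbid v (s.idx j) else 0 := by
    rw [← Finset.sum_add_distrib]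
    exact Finset.sum_congr rfl fun j _ => by split_ifs <;> simp
  unfold Mechanism.strictUtility
  simp only [Mempool.ite_overbid]
  rw [h1, h2, h3]
  simp only [burningSecondPrice]
  ring

theorem expectedUtility_eq (hm : 1 ≤ numConfirmed c γ k) (w : Bool) {n : ℕ} (v : Fin n → ℝ≥0)
    (C : Finset (Fin n)) (P : Mempool n) (s : Selection P.size (k + k')) :
    (burningSecondPrice c γ hc hγ k k' ρ τ).expectedUtility γ w v C P s =
      (if w then γ * ∑ j ∈ Finset.range k', (τ.bidAt (P.bid ∘ s.idx) (k + j) : ℝ) else 0)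
        - ∑ t ∈ P.own C, γ * P.overbid v t
      + confirmProb c γ k * ∑ j, if τ.rank (P.bid ∘ s.idx) j < k then
          if s.idx j ∈ P.own C then (P.value v (s.idx j) : ℝ)
            - τ.bidAt (P.bid ∘ s.idx) k + γ * P.overbid v (s.idx j) else 0
          else 0 := by
  rw [← sum_confirmation_mul_affine hc hγ (k' := k') ρ τ hm]
  unfold Mechanism.expectedUtility
  exact Finset.sum_congr rfl fun S _ => by rw [strictUtility_eq]

/-! ### Budget feasibility and determinism -/

theorem mem_support_confirmation {l : ℕ} {e : Fin l → ℝ≥0} {S : Finset (Fin l)} :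
    S ∈ ((burningSecondPrice c γ hc hγ k k' ρ τ).confirmation e).support ↔
      ∃ T ⊆ Finset.range k, T.card = numConfirmed c γ k ∧ τ.ofRanks e T = S := by
  refine (PMF.mem_support_map_iff _ _ _).trans ?_
  simp only [PMF.mem_support_uniformOfFinset_iff, Finset.mem_powersetCard, and_assoc]
  rfl

theorem burningSecondPrice_isTFM (hk' : k' ≤ numConfirmed c γ k) :
    (burningSecondPrice c γ hc hγ k k' ρ τ).IsTFM := by
  intro l hl e S hS
  obtain ⟨T, hT, hTc, rfl⟩ := (mem_support_confirmation hc hγ ρ τ).1 hS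
  refine ⟨fun j hj => if_neg hj, fun j => ?_, ?_⟩
  · change (if j ∈ _ then (τ.bidAt e k : ℝ) else 0) ≤ _
    split_ifs with h
    · have := Finset.mem_range.1 (hT ((τ.mem_ofRanks e).1 h))
      exact_mod_cast τ.bidAt_le e this.le
    · exact NNReal.coe_nonneg _
  · have h1 : ∑ j ∈ τ.ofRanks e T, (burningSecondPrice c γ hc hγ k k' ρ τ).payment e
        (τ.ofRanks e T) j = (τ.ofRanks e T).card * (τ.bidAt e k : ℝ) := by
      rw [← nsmul_eq_mul, ← Finset.sum_const]
      exact Finset.sum_congr rfl fun j hj => if_pos hj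
    have h2 : ∑ j ∈ Finset.range k', (τ.bidAt e (k + j) : ℝ) ≤ k' * (τ.bidAt e k : ℝ) := by
      rw [← nsmul_eq_mul]
      refine (Finset.sum_le_card_nsmul _ _ _ fun j _ => ?_).trans_eq (by rw [Finset.card_range])
      exact_mod_cast τ.bidAt_antitone e (Nat.le_add_right k j)
    have h0 : (0 : ℝ) ≤ τ.bidAt e k := NNReal.coe_nonneg _
    have h3 : γ * ∑ j ∈ Finset.range k', (τ.bidAt e (k + j) : ℝ) ≤
        ∑ j ∈ Finset.range k', (τ.bidAt e (k + j) : ℝ) :=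
      mul_le_of_le_one_left (Finset.sum_nonneg fun _ _ => NNReal.coe_nonneg _) hγ
    rw [h1]
    refine h3.trans (h2.trans ?_)
    -- In a block of at most `k` bids fewer than `numConfirmed c γ k` bids may be confirmed, but
    -- then the price is 0. In a longer block exactly that many pay, and `k'` is no larger.
    rcases le_or_gt l k with h | h
    · simp [τ.bidAt_of_le e h]
    · rw [τ.card_ofRanks e (hT.trans (Finset.range_subset_range.2 h.le)), hTc]
      gcongr

theorem burningSecondPrice_isDeterministic_iff (hγ0 : 0 < γ) (hm : 1 ≤ numConfirmed c γ k) :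
    (burningSecondPrice c γ hc hγ k k' ρ τ).IsDeterministic ↔ c = 1 ∧ γ = 1 := by
  have hmk := numConfirmed_le hc hγ k
  constructor
  · intro h
    -- A block of exactly `k` bids fills all eligible slots and nothing else; the values of the bids
    -- are irrelevant.
    obtain ⟨S, hS⟩ := h k (Nat.le_add_right k k') (fun _ => 0)
    have huniq : ∀ T ⊆ Finset.range k, T.card = numConfirmed c γ k →
        τ.ofRanks (fun _ : Fin k => 0) T = S := by
      intro T hT hTc
      have := (mem_support_confirmation hc hγ (k' := k') ρ τ
        (e := fun _ : Fin k => 0)).2 ⟨T, hT, hTc, rfl⟩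
      rw [hS] at this
      simpa using this
    -- Each rank lies in some possible choice of confirmed slots, and all choices yield `S`. So `S`
    -- is everything and `numConfirmed c γ k` equals `k`.
    have hmem : ∀ j : Fin k, j ∈ S := by
      intro j
      obtain ⟨T, hjT, hT, hTc⟩ := Finset.exists_subsuperset_card_eq
        (s := {τ.rank (fun _ => 0) j}) (t := Finset.range k) (n := numConfirmed c γ k)
        (by simpa using τ.rank_lt _ j) (by simpa using hm) (by simpa using hmk)
      rw [← huniq T hT hTc, Ranking.mem_ofRanks]
      simpa using hjT
    obtain ⟨T, hT, hTc⟩ := Finset.exists_subset_card_eq (s := Finset.range k)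
      (n := numConfirmed c γ k) (by simpa using hmk)
    have hSc : S.card = numConfirmed c γ k := by
      rw [← huniq T hT hTc, Ranking.card_ofRanks _ _ hT, hTc]
    have hSk : S.card = k := by
      rw [Finset.eq_univ_iff_forall.2 hmem, Finset.card_univ, Fintype.card_fin]
    have h1 := numConfirmed_mul_le hc hγ0.le k
    rw [← hSc, hSk] at h1
    have hk : (0 : ℝ) < k := by exact_mod_cast (by omega : 0 < k)
    have hcγ : (c : ℝ) ≤ γ := by nlinarith
    have hc1 : c ≤ 1 := by exact_mod_cast hcγ.trans hγ
    have hc' : (1 : ℝ) ≤ c := by exact_mod_cast hc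
    exact ⟨by omega, by linarith⟩
  · rintro ⟨rfl, rfl⟩ l - e
    have hnum : numConfirmed 1 1 k = k := by simp [numConfirmed]
    refine ⟨τ.ofRanks e (Finset.range k), ?_⟩
    rw [← PMF.support_eq_singleton_iff_eq_pure]
    ext S
    rw [mem_support_confirmation, hnum, Set.mem_singleton_iff]
    constructor
    · rintro ⟨T, hT, hTc, rfl⟩
      rw [Finset.eq_of_subset_of_card_le hT (by simp [hTc])]
    · rintro rfl
      exact ⟨_, le_rfl, Finset.card_range k, rfl⟩

end Auction

/-! ### Exchange argument, mempools, and the honest block -/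

/-- After cancelling `U ∩ I`, the largest value on `U \ I` separates the two sides: it bounds `U \
I` from above and `I` from below. Cardinalities matter only if `U` leaves `I`, that is, when the
honest block omits a bid and is therefore full. -/
theorem sum_le_sum_of_dominated {α : Type*} {U I : Finset α} {g : α → ℝ} (h0 : ∀ i, 0 ≤ g i)
    (hdom : ∀ i ∉ I, ∀ j ∈ I, g i ≤ g j) (hcard : ∀ i ∈ U, i ∉ I → U.card ≤ I.card) :
    ∑ i ∈ U, g i ≤ ∑ i ∈ I, g i := by
  classical
  rw [← Finset.sum_inter_add_sum_sdiff U I, ← Finset.sum_inter_add_sum_sdiff I U,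
    Finset.inter_comm I U]
  gcongr 1
  rcases (U \ I).eq_empty_or_nonempty with h | h
  · rw [h, Finset.sum_empty]
    exact Finset.sum_nonneg fun _ _ => h0 _
  · obtain ⟨x, hx, hmax⟩ := Finset.exists_max_image _ g h
    have hx' := Finset.mem_sdiff.1 hx
    have hc : (U \ I).card ≤ (I \ U).card := by
      have h1 := hcard x hx'.1 hx'.2
      have h2 := Finset.card_inter_add_card_sdiff U I
      have h3 := Finset.card_inter_add_card_sdiff I U
      rw [Finset.inter_comm] at h3
      omega
    calc ∑ i ∈ U \ I, g i ≤ (U \ I).card • g x := Finset.sum_le_card_nsmul _ _ _ hmax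
      _ ≤ (I \ U).card • g x := by
        rw [nsmul_eq_mul, nsmul_eq_mul]
        exact mul_le_mul_of_nonneg_right (by exact_mod_cast hc) (h0 x)
      _ ≤ ∑ i ∈ I \ U, g i := Finset.card_nsmul_le_sum _ _ _ fun j hj =>
        hdom x hx'.2 j (Finset.mem_sdiff.1 hj).1

namespace Mempool

variable {n : ℕ} {P : Mempool n} {v b : Fin n → ℝ≥0} {C : Finset (Fin n)}

theorem pos_mem_own {i : Fin n} : P.pos i ∈ P.own C ↔ i ∈ C := by
  simp [own]

theorem value_pos (i : Fin n) : P.value v (P.pos i) = v i := P.pos.injective.extend_apply _ _ _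

theorem value_fake {t : Fin P.size} (ht : t ∉ Set.range P.pos) : P.value v t = 0 :=
  Function.extend_apply' _ _ _ ht

theorem value_congr (h : ∀ i ∈ C, b i = v i) {t : Fin P.size} (ht : t ∈ P.own C) :
    P.value v t = P.value b t := by
  by_cases hr : t ∈ Set.range P.pos
  · obtain ⟨i, rfl⟩ := hr
    rw [value_pos, value_pos, h i (pos_mem_own.1 ht)]
  · rw [value_fake hr, value_fake hr]

theorem Reachable.bid_eq_value (h : P.Reachable b C) {t : Fin P.size} (ht : t ∉ P.own C) :
    P.bid t = P.value b t := by
  by_cases hr : t ∈ Set.range P.pos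
  · obtain ⟨i, rfl⟩ := hr
    rw [value_pos, h i (fun hi => ht (pos_mem_own.2 hi))]
  · refine absurd ?_ ht
    simp only [own, Finset.mem_filter, Finset.mem_univ, true_and]
    exact fun i hi => (hr ⟨i, hi⟩).elim

theorem mem_own_ofBids {i : Fin n} : i ∈ (ofBids b).own C ↔ i ∈ C :=
  pos_mem_own (P := ofBids b)

theorem value_ofBids : (ofBids b).value v = v := funext fun i => value_pos (P := ofBids b) i

end Mempool

section Auction

variable {c : ℕ} {γ : ℝ} (hc : 1 ≤ c) (hγ : γ ≤ 1) {k k' : ℕ} (ρ τ : Ranking)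

theorem rank_inclusion {m : ℕ} (b : Fin m → ℝ≥0)
    (j : Fin ((burningSecondPrice c γ hc hγ k k' ρ τ).inclusion b).len) :
    ρ.rank b (((burningSecondPrice c γ hc hγ k k' ρ τ).inclusion b).idx j) = j :=
  congrArg Fin.val ((ρ.perm b).symm_apply_apply (Fin.castLE (min_le_right _ _) j))

theorem mem_range_inclusion {m : ℕ} {b : Fin m → ℝ≥0} {t : Fin m} (ht : ρ.rank b t < k + k') :
    t ∈ Set.range ((burningSecondPrice c γ hc hγ k k' ρ τ).inclusion b).idx :=
  ⟨⟨ρ.rank b t, lt_min ht (ρ.rank_lt b t)⟩, ρ.rank_injective b (by rw [rank_inclusion])⟩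

theorem le_of_not_mem_inclusion {m : ℕ} {b : Fin m → ℝ≥0} {t : Fin m}
    (ht : t ∉ Set.range ((burningSecondPrice c γ hc hγ k k' ρ τ).inclusion b).idx)
    (j : Fin ((burningSecondPrice c γ hc hγ k k' ρ τ).inclusion b).len) :
    b t ≤ b (((burningSecondPrice c γ hc hγ k k' ρ τ).inclusion b).idx j) := by
  have h1 : k + k' ≤ ρ.rank b t := not_lt.1 fun h => ht (mem_range_inclusion hc hγ ρ τ h)
  rw [← ρ.bidAt_rank b t]
  refine ρ.bidAt_le b ?_
  rw [rank_inclusion]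
  exact (j.isLt.le.trans (Selection.len_le _)).trans h1

theorem len_inclusion_of_not_mem {m : ℕ} {b : Fin m → ℝ≥0} {t : Fin m}
    (ht : t ∉ Set.range ((burningSecondPrice c γ hc hγ k k' ρ τ).inclusion b).idx) :
    ((burningSecondPrice c γ hc hγ k k' ρ τ).inclusion b).len = k + k' := by
  have h1 : k + k' ≤ ρ.rank b t := not_lt.1 fun h => ht (mem_range_inclusion hc hγ ρ τ h)
  exact min_eq_left (h1.trans (ρ.rank_lt b t).le)

theorem le_bidAt_of_not_mem_inclusion (hk' : 1 ≤ k') {m : ℕ} {b : Fin m → ℝ≥0} {t : Fin m}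
    (ht : t ∉ Set.range ((burningSecondPrice c γ hc hγ k k' ρ τ).inclusion b).idx) :
    b t ≤ τ.bidAt (b ∘ ((burningSecondPrice c γ hc hγ k k' ρ τ).inclusion b).idx) k := by
  have h := len_inclusion_of_not_mem hc hγ ρ τ ht
  -- An omitted bid means a full block, and `1 ≤ k'` puts rank `k` inside it, so the price is an
  -- actual included bid.
  rw [Ranking.bidAt, dif_pos (by omega)]
  exact le_of_not_mem_inclusion hc hγ ρ τ ht _

/-- The honest block maximizes the sum of truncated bids. -/
theorem sum_min_le_inclusion {n : ℕ} (b : Fin n → ℝ≥0) (p : ℝ≥0) (U : Finset (Fin n))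
    (hU : U.card ≤ k + k') :
    ∑ i ∈ U, min (p : ℝ) (b i) ≤ ∑ r ∈ Finset.range (k + k'), min (p : ℝ)
      (τ.bidAt (b ∘ ((burningSecondPrice c γ hc hγ k k' ρ τ).inclusion b).idx) r) := by
  refine le_of_le_of_eq ?_ (τ.sum_range_bidAt
    (b ∘ ((burningSecondPrice c γ hc hγ k k' ρ τ).inclusion b).idx) (Selection.len_le _)
    (fun _ x => min (p : ℝ) x) (by simp)).symm
  have h := sum_le_sum_of_dominated (U := U)
    (I := Finset.univ.map ((burningSecondPrice c γ hc hγ k k' ρ τ).inclusion b).idx)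
    (g := fun i => min (p : ℝ) (b i)) (fun i => by positivity) ?_ ?_
  · rwa [Finset.sum_map] at h
  · intro i hi j hj
    obtain ⟨j, -, rfl⟩ := Finset.mem_map.1 hj
    refine min_le_min le_rfl (NNReal.coe_le_coe.2 (le_of_not_mem_inclusion hc hγ ρ τ ?_ j))
    simpa using hi
  · intro i _ hi
    rw [Finset.card_map, Finset.card_univ, Fintype.card_fin,
      len_inclusion_of_not_mem hc hγ ρ τ (t := i) (by simpa using hi)]
    exact hU

/-- The expected utility of players who bid truthfully, when no bid outside the block exceeds the
price. -/
theorem expectedUtility_of_truthful (hm : 1 ≤ numConfirmed c γ k) (w : Bool) {n : ℕ}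
    {v : Fin n → ℝ≥0} {C : Finset (Fin n)} {P : Mempool n}
    (hT : ∀ t ∈ P.own C, P.bid t = P.value v t) (s : Selection P.size (k + k'))
    (hs : ∀ t ∉ Set.range s.idx, P.bid t ≤ τ.bidAt (P.bid ∘ s.idx) k) :
    (burningSecondPrice c γ hc hγ k k' ρ τ).expectedUtility γ w v C P s =
      (if w then γ * ∑ j ∈ Finset.range k', (τ.bidAt (P.bid ∘ s.idx) (k + j) : ℝ) else 0) +
      confirmProb c γ k *
        ∑ t ∈ P.own C, max ((P.bid t : ℝ) - τ.bidAt (P.bid ∘ s.idx) k) 0 := by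
  have h0 : ∀ t ∈ P.own C, P.overbid v t = 0 := by
    intro t ht
    simp [Mempool.overbid, hT t ht]
  rw [expectedUtility_eq hc hγ ρ τ hm, Finset.sum_eq_zero (s := P.own C) fun i hi => by
    rw [h0 i hi, mul_zero], sub_zero]
  congr 2
  rw [← Finset.sum_ite_mem_eq (P.own C)]
  -- The positive part extends the sum from eligible slots to all own transactions: ineligible and
  -- omitted bids are at most the price.
  refine Fintype.sum_of_injective s.idx s.idx.injective _ _ (fun t ht => ?_) fun j => ?_
  · rw [max_eq_right (sub_nonpos.2 (NNReal.coe_le_coe.2 (hs t ht))), ite_self]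
  · by_cases hj : s.idx j ∈ P.own C
    · rw [if_pos hj, if_pos hj, h0 _ hj, mul_zero, add_zero, ← hT _ hj]
      split_ifs with hr
      · have h1 := τ.bidAt_le (P.bid ∘ s.idx) hr.le
        exact (max_eq_left (sub_nonneg.2 (NNReal.coe_le_coe.2 h1))).symm
      · have h1 := τ.le_bidAt (P.bid ∘ s.idx) (not_lt.1 hr)
        exact (max_eq_right (sub_nonpos.2 (NNReal.coe_le_coe.2 h1))).symm
    · rw [if_neg hj, if_neg hj, ite_self]

/-- The expected utility of honest players. -/
theorem expectedUtility_ofBids (hm : 1 ≤ numConfirmed c γ k) (hk' : 1 ≤ k') (w : Bool) {n : ℕ}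
    {v b : Fin n → ℝ≥0} {C : Finset (Fin n)} (hC : ∀ i ∈ C, b i = v i) :
    (burningSecondPrice c γ hc hγ k k' ρ τ).expectedUtility γ w v C (Mempool.ofBids b)
        ((burningSecondPrice c γ hc hγ k k' ρ τ).inclusion b) =
      (if w then γ * ∑ j ∈ Finset.range k', (τ.bidAt
        (b ∘ ((burningSecondPrice c γ hc hγ k k' ρ τ).inclusion b).idx) (k + j) : ℝ) else 0) +
      confirmProb c γ k * ∑ i ∈ C, max ((b i : ℝ) - τ.bidAt
        (b ∘ ((burningSecondPrice c γ hc hγ k k' ρ τ).inclusion b).idx) k) 0 := by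
  have hown : (Mempool.ofBids b).own C = C := Finset.ext fun i => Mempool.mem_own_ofBids
  refine (expectedUtility_of_truthful hc hγ (k' := k') ρ τ hm w (P := Mempool.ofBids b) ?_
    ((burningSecondPrice c γ hc hγ k k' ρ τ).inclusion b)
    fun t ht => le_bidAt_of_not_mem_inclusion hc hγ ρ τ hk' ht).trans ?_
  · intro t ht
    rw [Mempool.value_ofBids]
    exact hC t (Mempool.mem_own_ofBids.1 ht)
  · rw [hown]
    rfl

/-! ### Coalitions containing the miner -/

/-- A bound on the expected utility of a deviating coalition with the miner. -/
theorem expectedUtility_le (hγ0 : 0 ≤ γ) (hm : 1 ≤ numConfirmed c γ k) {n : ℕ}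
    {v b : Fin n → ℝ≥0} {C : Finset (Fin n)} (hC : ∀ i ∈ C, b i = v i) {P : Mempool n}
    (hP : P.Reachable b C) (s : Selection P.size (k + k')) :
    (burningSecondPrice c γ hc hγ k k' ρ τ).expectedUtility γ true v C P s ≤
      γ * (∑ j, min (τ.bidAt (P.bid ∘ s.idx) k : ℝ) (P.value b (s.idx j))
          - k * τ.bidAt (P.bid ∘ s.idx) k) +
      confirmProb c γ k *
        ∑ j, if s.idx j ∈ P.own C then
          max ((P.value b (s.idx j) : ℝ) - τ.bidAt (P.bid ∘ s.idx) k) 0 else 0 := by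
  set e := P.bid ∘ s.idx with he
  have hpen : ∑ j, (if s.idx j ∈ P.own C then γ * P.overbid v (s.idx j) else 0) ≤
      ∑ t ∈ P.own C, γ * P.overbid v t := by
    rw [← Finset.sum_map Finset.univ s.idx
      (fun t => if t ∈ P.own C then γ * P.overbid v t else 0), ← Finset.sum_ite_mem_eq (P.own C)]
    refine Finset.sum_le_sum_of_subset_of_nonneg (Finset.subset_univ _) fun t _ _ => ?_
    have := P.overbid_nonneg v t
    split_ifs <;> positivity
  -- Revenue, penalties and the term `k` times the price all become sums over block positions, so
  -- that the bound can be checked slot by slot.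
  rw [expectedUtility_eq hc hγ ρ τ hm, if_pos rfl, τ.sum_bidAt_add _ s.len_le,
    ← τ.sum_rank_lt_bidAt, ← he]
  refine (add_le_add_left (sub_le_sub_left hpen _) _).trans ?_
  rw [← Finset.sum_sub_distrib]
  simp only [Finset.mul_sum]
  rw [← Finset.sum_sub_distrib, ← Finset.sum_add_distrib, ← Finset.sum_add_distrib]
  refine Finset.sum_le_sum fun j _ => ?_
  have hq0 : 0 ≤ confirmProb c γ k := confirmProb_nonneg
  have hq1 : confirmProb c γ k ≤ 1 := confirmProb_le_one hc hγ
  generalize confirmProb c γ k = q at hq0 hq1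
  have hle : τ.rank e j < k → (τ.bidAt e k : ℝ) ≤ e j := fun h =>
    NNReal.coe_le_coe.2 (τ.bidAt_le e h.le)
  have hge : ¬ τ.rank e j < k → (e j : ℝ) ≤ τ.bidAt e k := fun h =>
    NNReal.coe_le_coe.2 (τ.le_bidAt e (not_lt.1 h))
  by_cases ho : s.idx j ∈ P.own C
  · simp only [if_pos ho, Mempool.overbid, Mempool.value_congr hC ho]
    have hej : P.bid (s.idx j) = e j := rfl
    rw [hej]
    generalize (P.value b (s.idx j) : ℝ) = h
    generalize (τ.bidAt e k : ℝ) = p at hle hge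
    generalize (e j : ℝ) = x at hle hge
    by_cases hr : τ.rank e j < k
    · have hpx := hle hr
      rw [if_neg (not_le.2 hr), if_pos hr, if_pos hr]
      rcases le_total p h with hph | hph
      · rw [min_eq_left hph, max_eq_left (sub_nonneg.2 hph)]
        nlinarith [mul_nonneg (sub_nonneg.2 hq1) (mul_nonneg hγ0 (le_max_right (x - h) 0))]
      · rw [min_eq_right hph, max_eq_right (sub_nonpos.2 hph), max_eq_left (by linarith)]
        -- An eligible own bid `x` with value `h ≤ p ≤ x` overbids by at least `p - h`. The claim
        -- reduces to γ(p - h) ≤ γ(1 - q)(p - h) + q(p - h), which is where γ ≤ 1 enters.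
        nlinarith [mul_nonneg (sub_nonneg.2 hq1) (mul_nonneg hγ0 (sub_nonneg.2 hpx)),
          mul_nonneg (mul_nonneg hq0 (sub_nonneg.2 hγ)) (sub_nonneg.2 hph)]
    · have hpx := hge hr
      rw [if_pos (not_lt.1 hr), if_neg hr, if_neg hr]
      -- In a price slot the miner's gain from an overbid is cancelled by its penalty, leaving at
      -- most the true value.
      have h1 : x - max (x - h) 0 ≤ min p h := by
        refine le_min ?_ ?_
        · linarith [le_max_right (x - h) 0]
        · linarith [le_max_left (x - h) 0]
      nlinarith [mul_le_mul_of_nonneg_left h1 hγ0, mul_nonneg hq0 (le_max_right (h - p) 0)]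
  · simp only [if_neg ho, ← hP.bid_eq_value ho]
    have hej : P.bid (s.idx j) = e j := rfl
    rw [hej]
    by_cases hr : τ.rank e j < k
    · rw [if_neg (not_le.2 hr), if_pos hr, if_pos hr, min_eq_left (hle hr)]
      simp
    · rw [if_pos (not_lt.1 hr), if_neg hr, if_neg hr, min_eq_right (hge hr)]
      simp

theorem expectedUtility_le_honest (hγ0 : 0 ≤ γ) (hm : 1 ≤ numConfirmed c γ k) (hk' : 1 ≤ k')
    {n : ℕ} {v b : Fin n → ℝ≥0} {C : Finset (Fin n)} (hCc : C.card ≤ c)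
    (hC : ∀ i ∈ C, b i = v i) {P : Mempool n}
    (hP : P.Reachable b C) (s : Selection P.size (k + k')) :
    (burningSecondPrice c γ hc hγ k k' ρ τ).expectedUtility γ true v C P s ≤
      (burningSecondPrice c γ hc hγ k k' ρ τ).expectedUtility γ true v C (Mempool.ofBids b)
        ((burningSecondPrice c γ hc hγ k k' ρ τ).inclusion b) := by
  refine (expectedUtility_le hc hγ ρ τ hγ0 hm hC hP s).trans ?_
  rw [expectedUtility_ofBids hc hγ ρ τ hm hk' true hC, if_pos rfl]
  -- The remaining argument works for an arbitrary nonnegative `p`.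
  generalize τ.bidAt (P.bid ∘ s.idx) k = p
  have h1 : ∑ j, (if s.idx j ∈ P.own C then
      max ((P.value b (s.idx j) : ℝ) - p) 0 else 0) ≤ ∑ i ∈ C, max ((b i : ℝ) - p) 0 := by
    rw [← Finset.sum_map Finset.univ s.idx
      (fun t => if t ∈ P.own C then max ((P.value b t : ℝ) - p) 0 else 0)]
    refine (Finset.sum_le_sum_of_subset_of_nonneg (Finset.subset_univ _) fun t _ _ => ?_).trans_eq
      ?_
    · split_ifs <;> simp
    · rw [← Finset.sum_ite_mem_eq C]
      refine (Fintype.sum_of_injective P.pos P.pos.injective _ _ (fun t ht => ?_) fun i => ?_).symm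
      · simp [Mempool.value_fake ht]
      · simp only [Mempool.pos_mem_own, Mempool.value_pos]
  have h2 : ∑ j, min (p : ℝ) (P.value b (s.idx j)) ≤
      ∑ r ∈ Finset.range (k + k'), min (p : ℝ)
        (τ.bidAt (b ∘ ((burningSecondPrice c γ hc hγ k k' ρ τ).inclusion b).idx) r) := by
    -- Fakes have value 0 and add nothing, so only the users present in the block count, at most `k
    -- + k'` of them.
    refine le_trans (le_of_eq ?_) (sum_min_le_inclusion hc hγ ρ τ b p
      (Finset.univ.filter fun i => P.pos i ∈ Finset.univ.map s.idx) ?_)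
    · rw [← Finset.sum_map Finset.univ s.idx (fun t => min (p : ℝ) (P.value b t)),
        ← Finset.sum_ite_mem_eq, Finset.sum_filter]
      refine (Fintype.sum_of_injective P.pos P.pos.injective _ _ (fun t ht => ?_) fun i => ?_).symm
      · simp [Mempool.value_fake ht]
      · simp only [Mempool.value_pos]
    · refine le_trans (Finset.card_le_card_of_injOn P.pos (t := Finset.univ.map s.idx) ?_
        P.pos.injective.injOn) ?_
      · intro i hi
        simpa using hi
      · simpa using s.len_le
  generalize τ.bidAt (b ∘ ((burningSecondPrice c γ hc hγ k k' ρ τ).inclusion b).idx) = H at h2 ⊢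
  have h3 : ∑ r ∈ Finset.range k, min (p : ℝ) (H r) ≤ k * p := by
    refine (Finset.sum_le_card_nsmul _ _ (p : ℝ) fun r _ => min_le_left _ _).trans_eq ?_
    rw [Finset.card_range, nsmul_eq_mul]
  have h4 : max ((H k : ℝ) - p) 0 ≤
      ∑ j ∈ Finset.range k', ((H (k + j) : ℝ) - min (p : ℝ) (H (k + j))) := by
    -- The slot of rank `k` alone accounts for this loss of revenue; it exists since `1 ≤ k'`.
    refine le_trans ?_ (Finset.single_le_sum (a := 0)
      (fun j _ => sub_nonneg.2 (min_le_right _ _)) (Finset.mem_range.2 hk'))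
    rw [add_zero]
    refine max_le ?_ ?_
    · linarith [min_le_left (p : ℝ) (H k)]
    · linarith [min_le_right (p : ℝ) (H k)]
  rw [Finset.sum_sub_distrib] at h4
  rw [Finset.sum_range_add] at h2
  have h5 : ∑ i ∈ C, max ((b i : ℝ) - p) 0 ≤
      ∑ i ∈ C, max ((b i : ℝ) - H k) 0 + c * max ((H k : ℝ) - p) 0 := by
    calc ∑ i ∈ C, max ((b i : ℝ) - p) 0
        ≤ ∑ i ∈ C, (max ((b i : ℝ) - H k) 0 + max ((H k : ℝ) - p) 0) := by
          refine Finset.sum_le_sum fun i _ => max_le ?_ ?_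
          · linarith [le_max_left ((b i : ℝ) - H k) 0, le_max_left ((H k : ℝ) - p) 0]
          · linarith [le_max_right ((b i : ℝ) - H k) 0, le_max_right ((H k : ℝ) - p) 0]
      _ ≤ _ := by
          rw [Finset.sum_add_distrib, Finset.sum_const, nsmul_eq_mul]
          gcongr
  have h6 := mul_le_mul_of_nonneg_left (h1.trans h5) (confirmProb_nonneg (c := c) (γ := γ) (k := k))
  have h7 := mul_le_mul_of_nonneg_right (mul_confirmProb_le hc hγ0 (k := k))
    (le_max_right ((H k : ℝ) - p) 0)
  have h8 := mul_le_mul_of_nonneg_left (show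
    ∑ j, min (p : ℝ) (P.value b (s.idx j)) - k * p ≤
      ∑ j ∈ Finset.range k', (H (k + j) : ℝ) - max ((H k : ℝ) - p) 0 by linarith) hγ0
  linarith

/-! ### A single user facing an honest miner -/

/-- With an honest miner, no user can lower the price that it faces. -/
theorem bidAt_inclusion_le_of_eligible (hk' : 1 ≤ k') {n : ℕ} {b : Fin n → ℝ≥0} {i : Fin n}
    {P : Mempool n} (hP : P.Reachable b {i})
    {j : Fin ((burningSecondPrice c γ hc hγ k k' ρ τ).inclusion P.bid).len}
    (hj : ((burningSecondPrice c γ hc hγ k k' ρ τ).inclusion P.bid).idx j = P.pos i)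
    (hr : τ.rank (P.bid ∘ ((burningSecondPrice c γ hc hγ k k' ρ τ).inclusion P.bid).idx) j < k) :
    τ.bidAt (b ∘ ((burningSecondPrice c γ hc hγ k k' ρ τ).inclusion b).idx) k ≤
      τ.bidAt (P.bid ∘ ((burningSecondPrice c γ hc hγ k k' ρ τ).inclusion P.bid).idx) k := by
  -- Pigeonhole: the top `k + 1` truthful bids are at least the old price. If the new price were
  -- lower, each of them would be eligible, user `i` by `hr` and the others because their bids are
  -- unchanged, but only `k` ranks are eligible.
  by_contra! hlt
  -- The old price is then positive, so the honest block really contains a bid of rank `k`.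
  set s := (burningSecondPrice c γ hc hγ k k' ρ τ).inclusion P.bid with hs
  set s₀ := (burningSecondPrice c γ hc hγ k k' ρ τ).inclusion b with hs₀
  have hlen : k < s₀.len := by
    by_contra! h
    rw [τ.bidAt_of_le (b ∘ s₀.idx) h] at hlt
    exact not_lt_zero hlt
  set A := (τ.ofRanks (b ∘ s₀.idx) (Finset.range (k + 1))).map s₀.idx with hA
  have hAc : A.card = k + 1 := by
    rw [hA, Finset.card_map, τ.card_ofRanks _ (Finset.range_subset_range.2 hlen),
      Finset.card_range]
  have hsub : A.map P.pos ⊆ (Finset.univ.filter fun j => τ.rank (P.bid ∘ s.idx) j < k).map s.idx := by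
    intro t ht
    obtain ⟨i', hi', rfl⟩ := Finset.mem_map.1 ht
    by_cases hii : i' = i
    · rw [hii, ← hj]
      exact Finset.mem_map_of_mem _ (by simpa using hr)
    obtain ⟨j₀, hj₀, hi₀⟩ := Finset.mem_map.1 hi'
    have hbid : τ.bidAt (P.bid ∘ s.idx) k < P.bid (P.pos i') := by
      rw [hP i' (by simpa using hii), ← hi₀]
      refine hlt.trans_le (τ.bidAt_le (b ∘ s₀.idx) ?_)
      have := Finset.mem_range.1 ((τ.mem_ofRanks _).1 hj₀)
      omega
    have hmem : P.pos i' ∈ Set.range s.idx := by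
      by_contra h
      exact not_le.2 hbid (le_bidAt_of_not_mem_inclusion hc hγ ρ τ hk' h)
    obtain ⟨j', hj'⟩ := hmem
    rw [← hj']
    refine Finset.mem_map_of_mem _ (Finset.mem_filter.2 ⟨Finset.mem_univ _, ?_⟩)
    by_contra h
    have h' := τ.le_bidAt (P.bid ∘ s.idx) (not_lt.1 h)
    rw [Function.comp_apply, hj'] at h'
    exact not_le.2 hbid h'
  have h1 := Finset.card_le_card hsub
  rw [Finset.card_map P.pos, Finset.card_map s.idx, hAc] at h1
  have h2 := τ.card_rank_lt_le (P.bid ∘ s.idx) k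
  omega

theorem burningSecondPrice_uic (hγ0 : 0 ≤ γ) (hm : 1 ≤ numConfirmed c γ k) (hk' : 1 ≤ k') :
    (burningSecondPrice c γ hc hγ k k' ρ τ).UIC γ := by
  intro n v b i hi P hP
  have hC : ∀ i' ∈ ({i} : Finset (Fin n)), b i' = v i' := by simpa using hi
  rw [expectedUtility_ofBids hc hγ ρ τ hm hk' false hC]
  refine (expectedUtility_eq hc hγ (k' := k') ρ τ hm false v {i} P
    ((burningSecondPrice c γ hc hγ k k' ρ τ).inclusion P.bid)).trans_le ?_
  have hprice := fun j => bidAt_inclusion_le_of_eligible hc hγ (k := k) ρ τ hk' hP (j := j)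
  generalize τ.bidAt (b ∘ ((burningSecondPrice c γ hc hγ k k' ρ τ).inclusion b).idx) k = p₀
    at hprice ⊢
  generalize (burningSecondPrice c γ hc hγ k k' ρ τ).inclusion P.bid = s at hprice ⊢
  have hq0 : 0 ≤ confirmProb c γ k := confirmProb_nonneg
  have hq1 : confirmProb c γ k ≤ 1 := confirmProb_le_one hc hγ
  generalize confirmProb c γ k = q at hq0 hq1
  simp only [Bool.false_eq_true, if_false, zero_sub, zero_add, Finset.sum_singleton]
  have hp0 : (0 : ℝ) ≤ τ.bidAt (P.bid ∘ s.idx) k := NNReal.coe_nonneg _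
  -- A fake has value 0 and pays a nonnegative price, so it yields at most its refund; the user's
  -- own slot yields at most its truthful surplus plus its refund.
  have hterm : ∀ j, (if τ.rank (P.bid ∘ s.idx) j < k then
      if s.idx j ∈ P.own {i} then (P.value v (s.idx j) : ℝ)
        - τ.bidAt (P.bid ∘ s.idx) k + γ * P.overbid v (s.idx j) else 0 else 0) ≤
      (if s.idx j ∈ P.own {i} then γ * P.overbid v (s.idx j) else 0) +
      if s.idx j = P.pos i then max ((b i : ℝ) - p₀) 0 else 0 := by
    intro j
    have hov : 0 ≤ γ * P.overbid v (s.idx j) := mul_nonneg hγ0 (P.overbid_nonneg v _)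
    have hmax := le_max_right ((b i : ℝ) - p₀) 0
    by_cases hr : τ.rank (P.bid ∘ s.idx) j < k
    · rw [if_pos hr]
      by_cases ho : s.idx j ∈ P.own {i}
      · rw [if_pos ho, if_pos ho]
        by_cases hji : s.idx j = P.pos i
        · have h1 : (p₀ : ℝ) ≤ τ.bidAt (P.bid ∘ s.idx) k :=
            NNReal.coe_le_coe.2 (hprice j hji hr)
          rw [if_pos hji, hji, Mempool.value_pos, ← hi]
          linarith [le_max_left ((b i : ℝ) - p₀) 0]
        · have hfake : s.idx j ∉ Set.range P.pos := by
            rintro ⟨i', hi'⟩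
            rw [← hi', Mempool.pos_mem_own, Finset.mem_singleton] at ho
            exact hji (by rw [← hi', ho])
          rw [if_neg hji, Mempool.value_fake hfake, NNReal.coe_zero]
          linarith
      · rw [if_neg ho, if_neg ho]
        split_ifs <;> linarith
    · rw [if_neg hr]
      split_ifs <;> linarith
  have h1 := Finset.sum_le_sum fun j (_ : j ∈ Finset.univ) => hterm j
  rw [Finset.sum_add_distrib] at h1
  have h2 : ∑ j, (if s.idx j ∈ P.own {i} then γ * P.overbid v (s.idx j) else 0) ≤
      ∑ t ∈ P.own {i}, γ * P.overbid v t := by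
    rw [← Finset.sum_map Finset.univ s.idx
      (fun t => if t ∈ P.own {i} then γ * P.overbid v t else 0), ← Finset.sum_ite_mem_eq (P.own _)]
    refine Finset.sum_le_sum_of_subset_of_nonneg (Finset.subset_univ _) fun t _ _ => ?_
    have := P.overbid_nonneg v t
    split_ifs <;> positivity
  have h3 : ∑ j, (if s.idx j = P.pos i then max ((b i : ℝ) - p₀) 0 else 0) ≤
      max ((b i : ℝ) - p₀) 0 := by
    rw [← Finset.sum_map Finset.univ s.idx
      (fun t => if t = P.pos i then max ((b i : ℝ) - p₀) 0 else 0)]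
    refine (Finset.sum_le_sum_of_subset_of_nonneg (Finset.subset_univ _) fun t _ _ => ?_).trans_eq
      (Fintype.sum_ite_eq' _ _)
    split_ifs <;> simp
  have h4 := mul_le_mul_of_nonneg_left (h1.trans (add_le_add h2 h3)) hq0
  have h5 : 0 ≤ ∑ t ∈ P.own {i}, γ * P.overbid v t :=
    Finset.sum_nonneg fun t _ => mul_nonneg hγ0 (P.overbid_nonneg v t)
  -- Refunds arrive with probability at most 1, so they never exceed the penalties charged up front.
  have h6 := mul_le_of_le_one_left h5 hq1
  linarith

end Auction

end FeeMechanism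

theorem mainTheorem3 (c : ℕ) (hc : 1 ≤ c) (γ : ℝ) (hγ0 : 0 < γ) (hγ1 : γ ≤ 1) :
    (∀ B : ℕ, (∃ k k' : ℕ, FeeMechanism.AdmissibleParams c γ B k k') ↔ 1 + (c : ℝ) / γ ≤ (B : ℝ)) ∧
    ∀ (B k k' : ℕ), FeeMechanism.AdmissibleParams c γ B k k' →
      ∀ ρ τ : FeeMechanism.Ranking,
        (FeeMechanism.burningSecondPrice c γ hc hγ1 k k' ρ τ).blockSize = B ∧
        (FeeMechanism.burningSecondPrice c γ hc hγ1 k k' ρ τ).IsTFM ∧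
        (FeeMechanism.burningSecondPrice c γ hc hγ1 k k' ρ τ).UIC γ ∧
        (FeeMechanism.burningSecondPrice c γ hc hγ1 k k' ρ τ).MIC γ ∧
        (FeeMechanism.burningSecondPrice c γ hc hγ1 k k' ρ τ).SCP c γ ∧
        ((FeeMechanism.burningSecondPrice c γ hc hγ1 k k' ρ τ).IsDeterministic ↔
          c = 1 ∧ γ = 1) := by
  refine ⟨fun B => FeeMechanism.exists_admissibleParams_iff hc hγ0 B, ?_⟩
  rintro B k k' ⟨hB, hk', hkm⟩ ρ τ
  have hm := hk'.trans hkm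
  refine ⟨hB, FeeMechanism.burningSecondPrice_isTFM hc hγ1 ρ τ hkm,
    FeeMechanism.burningSecondPrice_uic hc hγ1 ρ τ hγ0.le hm hk', ?_, ?_,
    FeeMechanism.burningSecondPrice_isDeterministic_iff hc hγ1 ρ τ hγ0 hm⟩
  · intro n v b P hP s
    -- The miner alone is the coalition with no users.
    exact FeeMechanism.expectedUtility_le_honest hc hγ1 ρ τ hγ0.le hm hk' (by simp) (by simp) hP s
  · intro n v b C _ hCc hC P hP s
    exact FeeMechanism.expectedUtility_le_honest hc hγ1 ρ τ hγ0.le hm hk' hCc hC hP s
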